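/- Let $\Sigma=\{0,1\}$ and let $\Sigma^*$ be the set of finite strings over $\Sigma$. For $f:\Sigma^*\to\Sigma$ let $\bar f(x)$ be the string $x$ with the symbol $f(x)$ appended, let $f^{\mathsf{CoT}\text{-}T}=\bar f\circ\cdots\circ\bar f$ ($T$ times), and let $f^{\mathsf{e2e}\text{-}T}(x)$ be the last symbol of $f^{\mathsf{CoT}\text{-}T}(x)$. For a class $\mathcal F\subseteq\Sigma^{\Sigma^*}$, the rule $\mathrm{Cons}_{\mathsf{CoT}}$ is the following specification: given strings $z_1,\dots,z_m$, with $x_i$ denoting $z_i$ without its last $T$ symbols, return $\hat f^{\mathsf{e2e}\text{-}T}$ for some $\hat f\in\mathcal F$ with $z_i=\hat f^{\mathsf{CoT}\text{-}T}(x_i)$ for all $i$ (with arbitrary output if there is no such $\hat f$). There is a universal constant $C>0$ such that for every $\mathcal F\subseteq\{0,1\}^{\{0,1\}^*}$ with $\mathrm{VCdim}(\mathcal F)<\infty$ and every integer $T\ge 1$ there is a function $m:\mathbb R^2\to\mathbb N$ with $$m(\varepsilon,\delta)\le \frac{C}{\varepsilon}\Big(\mathrm{VCdim}(\mathcal F)\,\max\{1,\log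 T\}\,\max\{1,\log(1/\varepsilon)\}+\log(1/\delta)\Big)\qquad\text{for all } \varepsilon,\delta\in(0,1),$$ such that the following holds. The rule $\mathrm{Cons}_{\mathsf{CoT}}$ has an implementation, and for every implementation $A$ of $\mathrm{Cons}_{\mathsf{CoT}}$, every probability distribution $\mathcal D$ on $\Sigma^*$, every $f_*\in\mathcal F$, all $\varepsilon,\delta\in(0,1)$ and every $m'\ge m(\varepsilon,\delta)$, with probability at least $1-\delta$ over i.i.d. $x_1,\dots,x_{m'}\sim\mathcal D$, with $z_i=f_*^{\mathsf{CoT}\text{-}T}(x_i)$, $$\Pr_{x\sim\mathcal D}\big(A(z_1,\dots,z_{m'})(x)\ne f_*^{\mathsf{e2e}\text{-}T}(x)\big)\le\varepsilon .$$ -/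

import Mathlib

namespace CoTLearning

open MeasureTheory

/-- Strings over the alphabet `Σ = {0,1}`. -/
abbrev Str : Type := List Bool

/-- Next-token generators `f : Σ* → Σ`. -/
abbrev Generator : Type := Str → Bool

/-- The set of strings is countable; all of its subsets are events. -/
instance instMeasurableSpaceStr : MeasurableSpace Str := ⊤

/-- The apply-and-append map `x ↦ append(x, f(x))`. -/
def applyAppend (f : Generator) (x : Str) : Str := x ++ [f x]

/-- The `T`-step chain of thought: apply-and-append iterated `T` times. -/
def CoT (f : Generator) (T : ℕ) (x : Str) : Str := (applyAppend f)^[T] x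

/-- The end-to-end map: the last token of the `T`-step chain of thought. (The default value
`false` is only used for the empty string, which does not occur when `T ≥ 1`.) -/
def e2e (f : Generator) (T : ℕ) (x : Str) : Bool := (CoT f T x).getLastD false

/-- The class `H` of binary functions realizes every labelling of the finite set `S`. -/
def Shatters {X : Type*} (H : Set (X → Bool)) (S : Finset X) : Prop :=
  ∀ y : X → Bool, ∃ h ∈ H, ∀ x ∈ S, h x = y x

/-- The Vapnik-Chervonenkis dimension: the supremum of the sizes of shattered finite sets. -/
noncomputable def VCdim {X : Type*} (H : Set (X → Bool)) : ℕ∞ :=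
  ⨆ (S : Finset X) (_ : Shatters H S), (S.card : ℕ∞)

/-- A learning rule on chain-of-thought data: it maps a finite sequence of strings
`z₁, …, zₘ` (each an input followed by its `T` generated tokens) to a predictor. -/
abbrev CoTRule : Type := List Str → (Str → Bool)

/-- `f` reproduces each `z` in `S` from the input obtained by removing its last `T` tokens. -/
def CoTConsistent (f : Generator) (T : ℕ) (S : List Str) : Prop :=
  ∀ z ∈ S, z = CoT f T (z.rdrop T)

/-- `A` is an implementation of the rule `Cons_CoT` for the base class `F`: on every sequence
with which some member of `F` is consistent, it returns the end-to-end map of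
some consistent member of `F`. -/
def IsConsCoT (F : Set Generator) (T : ℕ) (A : CoTRule) : Prop :=
  ∀ S : List Str, (∃ f ∈ F, CoTConsistent f T S) →
    ∃ f ∈ F, CoTConsistent f T S ∧ A S = e2e f T

/-- The population 0-1 error of the predictor `h` against the end-to-end map of `fstar`. -/
noncomputable def popError (D : Measure Str) (fstar : Generator) (T : ℕ) (h : Str → Bool) : ℝ :=
  D.real {x | h x ≠ e2e fstar T x}

/-- The chain-of-thought training sequence of the inputs `x₁, …, xₘ`. -/
def cotSample (fstar : Generator) (T : ℕ) {m : ℕ} (x : Fin m → Str) : List Str :=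
  List.ofFn fun i => CoT fstar T (x i)

/-- The rule `A` learns the end-to-end class of `F` from chain-of-thought data with sample
complexity `m(ε, δ)`, in the realizable setting. -/
def CoTLearnsWith (F : Set Generator) (T : ℕ) (A : CoTRule) (m : ℝ → ℝ → ℕ) : Prop :=
  ∀ (D : Measure Str) [IsProbabilityMeasure D], ∀ fstar ∈ F,
    ∀ ε δ : ℝ, 0 < ε → ε < 1 → 0 < δ → δ < 1 →
      1 - δ ≤ (Measure.pi fun _ : Fin (m ε δ) => D).real
        {x | popError D fstar T (A (cotSample fstar T x)) ≤ ε}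

end CoTLearning

/-!
Two generators have the same chain of thought on `x` if and only if they agree at the `T` prefixes
that one of them produces from `x`. Which of `n` inputs a member of `F` gets wrong is therefore
determined by its values at `n * T` strings, so by the Sauer–Shelah lemma the class of
chain-of-thought errors has growth function at most `(e * n * T / d) ^ d`. The length `T` enters
only the base of this power, hence logarithmically in the sample size. A consistent rule errs by
more than `ε` only if the sample misses an error set of measure more than `ε`, and the `ε`-net
theorem, proved by symmetrization with a ghost sample, bounds the probability of this.
-/

namespace CoTLearning

open MeasureTheory
open scoped Finset

section Restrictions

variable {X Y : Type*}

/-- The restrictions to the finite set `S` of the members of a class of functions. As a function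
of `#S`, the largest possible number of restrictions is the growth function of the class. -/
def restrictions (H : Set (X → Y)) (S : Finset X) : Set (S → Y) := S.restrict '' H

theorem ncard_restrictions_image_le [Finite Y] {X' Y' : Type*} [Nonempty Y']
    {φ : (X → Y) → X' → Y'} {S : Finset X'} {P : Finset X}
    (hφ : (S.restrict ∘ φ).FactorsThrough P.restrict) (H : Set (X → Y)) :
    (restrictions (φ '' H) S).ncard ≤ (restrictions H P).ncard := by
  obtain ⟨e, he⟩ := (Function.factorsThrough_iff _).1 hφ
  have himage : restrictions (φ '' H) S = e '' restrictions H P := by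
    rw [restrictions, restrictions, ← Set.image_comp, ← Set.image_comp, he]
  rw [himage]
  exact Set.ncard_image_le (Set.toFinite _)

theorem exists_finset_restrict_eq [Finite Y] (H : Set (X → Y)) (S : Finset X) :
    ∃ R : Finset (X → Y), #R = (restrictions H S).ncard ∧
      ∀ h ∈ H, ∃ r ∈ R, ∀ x ∈ S, h x = r x := by
  obtain ⟨R, -, hR⟩ := Set.exists_subset_bijOn H (S.restrict (π := fun _ => Y))
  have hfin : R.Finite := hR.finite_iff_finite.2 (Set.toFinite _)
  refine ⟨hfin.toFinset, ?_, fun h hh => ?_⟩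
  · rw [restrictions, ← hR.image_eq, hR.injOn.ncard_image, Set.ncard_eq_toFinset_card R hfin]
  · obtain ⟨r, hr, hrh⟩ := hR.surjOn (Set.mem_image_of_mem _ hh)
    exact ⟨r, hfin.mem_toFinset.2 hr, fun x hx => (congrFun hrh ⟨x, hx⟩).symm⟩

end Restrictions

section VCDimension

variable {X : Type*} {H : Set (X → Bool)} {d : ℕ}

theorem Shatters.card_le {S : Finset X} (hS : Shatters H S) (hd : VCdim H ≤ d) : #S ≤ d := by
  have h : (#S : ℕ∞) ≤ VCdim H := le_iSup₂_of_le S hS le_rfl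
  exact_mod_cast h.trans hd

open Classical in
/-- The restrictions of a class of binary functions to `S`, encoded as the subsets of `S` where
they are true: the form in which the library states the Sauer–Shelah lemma. -/
noncomputable def restrictionSupports (H : Set (X → Bool)) (S : Finset X) : Finset (Finset S) :=
  {t | ∃ h ∈ H, ∀ x : S, x ∈ t ↔ h x}

theorem mem_restrictionSupports {S : Finset X} {t : Finset S} :
    t ∈ restrictionSupports H S ↔ ∃ h ∈ H, ∀ x : S, x ∈ t ↔ h x := by
  simp [restrictionSupports]

theorem ncard_restrictions_le_card_restrictionSupports (S : Finset X) :
    (restrictions H S).ncard ≤ #(restrictionSupports H S) := by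
  rw [← Set.ncard_coe_finset]
  refine Set.ncard_le_ncard_of_injOn (fun g => ({x | g x} : Finset S)) ?_ ?_
  · rintro _ ⟨h, hh, rfl⟩
    exact Finset.mem_coe.2 (mem_restrictionSupports.2 ⟨h, hh, fun x => Finset.mem_filter_univ x⟩)
  · intro g _ g' _ hgg'
    ext x
    simpa [← Bool.eq_iff_iff] using Finset.ext_iff.1 hgg' x

theorem shatters_map_of_restrictionSupports [DecidableEq X] {S : Finset X} {s : Finset S}
    (hs : (restrictionSupports H S).Shatters s) :
    Shatters H (s.map (Function.Embedding.subtype _)) := by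
  intro y
  obtain ⟨t, ht, hst⟩ := hs (Finset.filter_subset (fun x : S => y x = true) s)
  obtain ⟨h, hh, hht⟩ := mem_restrictionSupports.1 ht
  refine ⟨h, hh, Finset.forall_mem_map.2 fun x hx => Bool.eq_iff_iff.2 ?_⟩
  have hxt := Finset.ext_iff.1 hst x
  simp only [Finset.mem_inter, Finset.mem_filter, hx, true_and] at hxt
  exact (hht x).symm.trans hxt

theorem ncard_restrictions_le_sum_choose (hd : VCdim H ≤ d) (S : Finset X) :
    (restrictions H S).ncard ≤ ∑ i ∈ Finset.Iic d, (#S).choose i := by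
  classical
  have hvc : (restrictionSupports H S).vcDim ≤ d := by
    refine Finset.sup_le fun s hs => ?_
    have hmap := shatters_map_of_restrictionSupports (Finset.mem_shatterer.1 hs)
    simpa only [Finset.card_map] using hmap.card_le hd
  calc (restrictions H S).ncard
      ≤ #(restrictionSupports H S) := ncard_restrictions_le_card_restrictionSupports S
    _ ≤ #(restrictionSupports H S).shatterer := Finset.card_le_card_shatterer _
    _ ≤ ∑ i ∈ Finset.Iic (restrictionSupports H S).vcDim, (Fintype.card S).choose i :=
        Finset.card_shatterer_le_sum_vcDim
    _ ≤ ∑ i ∈ Finset.Iic d, (#S).choose i := by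
        rw [Fintype.card_coe]
        exact Finset.sum_le_sum_of_subset (Finset.Iic_subset_Iic.2 hvc)

theorem subsingleton_of_VCdim_eq_zero (h : VCdim H = 0) : H.Subsingleton := by
  intro f hf g hg
  funext x
  have hcard : (restrictions H {x}).ncard ≤ 1 := by
    exact (ncard_restrictions_le_sum_choose (d := 0) h.le {x}).trans_eq rfl
  have hfg := (Set.ncard_le_one_iff).1 hcard (Set.mem_image_of_mem _ hf)
    (Set.mem_image_of_mem _ hg)
  exact congrFun hfg ⟨x, Finset.mem_singleton_self x⟩

theorem sum_choose_le_exp_one_mul_div_pow {n : ℕ} (hd : 0 < d) (hdn : d ≤ n) :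
    (∑ i ∈ Finset.Iic d, (n.choose i : ℝ)) ≤ (Real.exp 1 * n / d) ^ d := by
  have hn : 0 < n := hd.trans_le hdn
  set r : ℝ := d / n with hr
  have hr0 : 0 < r := by positivity
  have hr1 : r ≤ 1 := div_le_one_of_le₀ (by exact_mod_cast hdn) (by positivity)
  -- The weights `r ^ (i - d) ≥ 1` turn the truncated sum into part of a binomial expansion.
  have hweighted : (∑ i ∈ Finset.Iic d, (n.choose i : ℝ)) * r ^ d ≤ Real.exp 1 ^ d := by
    calc (∑ i ∈ Finset.Iic d, (n.choose i : ℝ)) * r ^ d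
        ≤ ∑ i ∈ Finset.Iic d, r ^ i * n.choose i := by
          rw [Finset.sum_mul]
          refine Finset.sum_le_sum fun i hi => ?_
          rw [mul_comm]
          gcongr ?_ * _
          exact pow_le_pow_of_le_one hr0.le hr1 (Finset.mem_Iic.1 hi)
      _ ≤ ∑ i ∈ Finset.Iic n, r ^ i * n.choose i :=
          Finset.sum_le_sum_of_subset_of_nonneg (Finset.Iic_subset_Iic.2 hdn)
            fun i _ _ => by positivity
      _ = (r + 1) ^ n := by simp [add_pow, Nat.range_succ_eq_Iic]
      _ ≤ Real.exp r ^ n := by gcongr; exact Real.add_one_le_exp r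
      _ = Real.exp 1 ^ d := by
          rw [← Real.exp_nat_mul, ← Real.exp_nat_mul, hr]; congr 1; field_simp
  calc (∑ i ∈ Finset.Iic d, (n.choose i : ℝ)) ≤ Real.exp 1 ^ d / r ^ d :=
        (le_div_iff₀ (by positivity)).2 hweighted
    _ = (Real.exp 1 * n / d) ^ d := by rw [← div_pow, hr]; congr 1; field_simp

end VCDimension

section Symmetrization

variable {X ι : Type*} [Fintype ι]

/-- Exchange the components of the pairs selected by `σ`. On a double sample, whose first
components are the training points and whose second components are the ghost points, these
exchanges preserve the distribution. -/
def swapPairs (σ : ι → Bool) (y : ι → X × X) : ι → X × X :=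
  fun i => if σ i then (y i).swap else y i

theorem measurePreserving_swapPairs [MeasurableSpace X] (D : Measure X) [SigmaFinite D]
    (σ : ι → Bool) :
    MeasurePreserving (swapPairs (X := X) σ) (Measure.pi fun _ => D.prod D)
      (Measure.pi fun _ => D.prod D) := by
  refine measurePreserving_pi (fun _ : ι => D.prod D) (fun _ => D.prod D)
    (f := fun i p => if σ i then p.swap else p) fun i => ?_
  cases σ i
  · exact MeasurePreserving.id _
  · simpa using Measure.measurePreserving_swap

/-- The double samples on which `h` is false at every training point but true at no fewer than
`k` ghost points. -/
def ghostEvent (h : X → Bool) (k : ℕ) : Set (ι → X × X) :=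
  {y | (∀ i, h (y i).1 = false) ∧ k ≤ #{i | h (y i).2}}

theorem mem_ghostEvent_congr {h h' : X → Bool} {k : ℕ} {y : ι → X × X}
    (hy : ∀ i, h (y i).1 = h' (y i).1 ∧ h (y i).2 = h' (y i).2) :
    y ∈ ghostEvent h k ↔ y ∈ ghostEvent h' k := by
  simp only [ghostEvent, Set.mem_ofPred_eq, hy]

theorem two_pow_mul_card_forall_eq_on [DecidableEq ι] (K : Finset ι) (σ₀ : ι → Bool) :
    2 ^ #K * #{σ : ι → Bool | ∀ i ∈ K, σ i = σ₀ i} = 2 ^ Fintype.card ι := by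
  have hpi : ({σ : ι → Bool | ∀ i ∈ K, σ i = σ₀ i} : Finset (ι → Bool)) =
      Fintype.piFinset fun i => if i ∈ K then {σ₀ i} else Finset.univ := by
    ext σ
    simp only [Finset.mem_filter_univ, Fintype.mem_piFinset]
    refine forall_congr' fun i => ?_
    split_ifs with hi <;> simp [hi]
  have hcard (i : ι) : #(if i ∈ K then {σ₀ i} else Finset.univ) = if i ∈ K then 1 else 2 := by
    split_ifs <;> simp
  rw [hpi, Fintype.card_piFinset]
  simp only [hcard, Finset.prod_ite, Finset.prod_const, one_pow, one_mul]
  rw [Finset.filter_not, Finset.filter_mem_eq_inter, Finset.univ_inter,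
    ← Finset.compl_eq_univ_sdiff, ← pow_add, Finset.card_add_card_compl]

open Classical in
theorem two_pow_mul_card_swapPairs_mem_ghostEvent_le (h : X → Bool) (k : ℕ) (y : ι → X × X) :
    2 ^ k * #{σ | swapPairs σ y ∈ ghostEvent h k} ≤ 2 ^ Fintype.card ι := by
  rcases Finset.eq_empty_or_nonempty {σ | swapPairs σ y ∈ ghostEvent h k} with hE | ⟨σ₀, hσ₀⟩
  · simp [hE]
  obtain ⟨-, hk⟩ := (Finset.mem_filter_univ _).1 hσ₀
  -- At a pair whose ghost point is marked, the other orientation would put a marked point in the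
  -- training sample, so the exchange is forced there.
  set K : Finset ι := {i | h (swapPairs σ₀ y i).2}
  have hforced (σ : ι → Bool) (hσ : swapPairs σ y ∈ ghostEvent h k) : ∀ i ∈ K, σ i = σ₀ i := by
    intro i hi
    have hghost := (Finset.mem_filter_univ _).1 hi
    have htrain := hσ.1 i
    unfold swapPairs at hghost htrain
    cases hσi : σ i <;> cases hσ₀i : σ₀ i <;> simp_all
  calc 2 ^ k * #{σ | swapPairs σ y ∈ ghostEvent h k}
      ≤ 2 ^ #K * #{σ : ι → Bool | ∀ i ∈ K, σ i = σ₀ i} := by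
        gcongr with σ
        · exact one_le_two
        · exact hforced σ
    _ = 2 ^ Fintype.card ι := two_pow_mul_card_forall_eq_on _ _

theorem exists_finset_swapPairs_mem (y : ι → X × X) :
    ∃ S : Finset X, #S ≤ 2 * Fintype.card ι ∧
      ∀ σ i, (swapPairs σ y i).1 ∈ S ∧ (swapPairs σ y i).2 ∈ S := by
  classical
  refine ⟨Finset.univ.image (fun i => (y i).1) ∪ Finset.univ.image (fun i => (y i).2), ?_,
    fun σ i => ?_⟩
  · rw [two_mul]
    exact (Finset.card_union_le _ _).trans
      (add_le_add Finset.card_image_le Finset.card_image_le)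
  · unfold swapPairs
    cases σ i <;> simp

open Classical in
theorem two_pow_mul_card_exists_swapPairs_mem_ghostEvent_le {H : Set (X → Bool)} {N : ℕ}
    (hN : ∀ S : Finset X, #S ≤ 2 * Fintype.card ι → (restrictions H S).ncard ≤ N) (k : ℕ)
    (y : ι → X × X) :
    2 ^ k * #{σ | ∃ h ∈ H, swapPairs σ y ∈ ghostEvent h k} ≤ N * 2 ^ Fintype.card ι := by
  obtain ⟨S, hScard, hS⟩ := exists_finset_swapPairs_mem y
  obtain ⟨R, hRcard, hR⟩ := exists_finset_restrict_eq H S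
  have hcover : ({σ | ∃ h ∈ H, swapPairs σ y ∈ ghostEvent h k} : Finset (ι → Bool)) ⊆
      R.biUnion fun r => {σ | swapPairs σ y ∈ ghostEvent r k} := by
    intro σ hσ
    obtain ⟨h, hh, hσh⟩ := (Finset.mem_filter_univ _).1 hσ
    obtain ⟨r, hr, hhr⟩ := hR h hh
    refine Finset.mem_biUnion.2 ⟨r, hr, (Finset.mem_filter_univ _).2 ?_⟩
    exact (mem_ghostEvent_congr fun i => ⟨hhr _ (hS σ i).1, hhr _ (hS σ i).2⟩).1 hσh
  calc 2 ^ k * #{σ | ∃ h ∈ H, swapPairs σ y ∈ ghostEvent h k}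
      ≤ 2 ^ k * ∑ r ∈ R, #{σ | swapPairs σ y ∈ ghostEvent r k} := by
        gcongr
        exact (Finset.card_le_card hcover).trans Finset.card_biUnion_le
    _ ≤ ∑ r ∈ R, 2 ^ Fintype.card ι := by
        rw [Finset.mul_sum]
        exact Finset.sum_le_sum fun r _ => two_pow_mul_card_swapPairs_mem_ghostEvent_le r k y
    _ ≤ N * 2 ^ Fintype.card ι := by
        rw [Finset.sum_const, smul_eq_mul, hRcard]
        gcongr
        exact hN S hScard

open Classical in
theorem card_mul_measureReal_le_of_measurePreserving {Ω : Type*} [MeasurableSpace Ω]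
    {μ : Measure Ω} [IsProbabilityMeasure μ] {g : ι → Ω → Ω}
    (hg : ∀ i, MeasurePreserving (g i) μ μ) {E : Set Ω} (hE : MeasurableSet E) {c : ℝ}
    (hc : ∀ ω, (#{i | g i ω ∈ E} : ℝ) ≤ c) : Fintype.card ι * μ.real E ≤ c := by
  have hmeas (i : ι) : MeasurableSet (g i ⁻¹' E) := (hg i).measurable hE
  have hint (i : ι) : Integrable ((g i ⁻¹' E).indicator (1 : Ω → ℝ)) μ :=
    (integrable_const 1).indicator (hmeas i)
  calc Fintype.card ι * μ.real E = ∑ i, μ.real (g i ⁻¹' E) := by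
        simp [(hg _).measureReal_preimage hE.nullMeasurableSet]
    _ = ∫ ω, ∑ i, (g i ⁻¹' E).indicator 1 ω ∂μ := by
        rw [integral_finsetSum _ fun i _ => hint i]
        simp only [integral_indicator_one (hmeas _)]
    _ ≤ ∫ _, c ∂μ := by
        refine integral_mono (integrable_finsetSum _ fun i _ => hint i) (integrable_const c)
          fun ω => ?_
        simpa [Set.indicator_apply, Finset.sum_boole] using hc ω
    _ = c := by simp

theorem measureReal_exists_ghostEvent_le [MeasurableSpace X] [Countable X]
    [MeasurableSingletonClass X] (D : Measure X) [IsProbabilityMeasure D] {H : Set (X → Bool)}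
    {N : ℕ} (hN : ∀ S : Finset X, #S ≤ 2 * Fintype.card ι → (restrictions H S).ncard ≤ N)
    (k : ℕ) :
    (Measure.pi fun _ : ι => D.prod D).real {y | ∃ h ∈ H, y ∈ ghostEvent h k} ≤ N / 2 ^ k := by
  classical
  have haverage := card_mul_measureReal_le_of_measurePreserving
    (fun σ : ι → Bool => measurePreserving_swapPairs D σ)
    (E := {y | ∃ h ∈ H, y ∈ ghostEvent h k}) MeasurableSet.of_discrete
    (c := N * 2 ^ Fintype.card ι / 2 ^ k) fun y => by
      rw [le_div_iff₀' (by positivity)]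
      exact_mod_cast two_pow_mul_card_exists_swapPairs_mem_ghostEvent_le hN k y
  rw [Fintype.card_fun, Fintype.card_bool, mul_div_right_comm, mul_comm] at haverage
  push_cast at haverage
  exact le_of_mul_le_mul_right haverage (by positivity)

end Symmetrization

section EpsilonNet

theorem mul_measureReal_le_measureReal_prod {α β : Type*} [MeasurableSpace α] [MeasurableSpace β]
    {μ : Measure α} {ν : Measure β} [IsFiniteMeasure μ] [IsFiniteMeasure ν] {A : Set α}
    {E : Set (α × β)} {c : ℝ} (hc : 0 ≤ c) (hE : MeasurableSet E)
    (hA : ∀ a ∈ A, c ≤ ν.real (Prod.mk a ⁻¹' E)) : c * μ.real A ≤ (μ.prod ν).real E := by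
  have hfubini : ∫ a, ν.real (Prod.mk a ⁻¹' E) ∂μ = (μ.prod ν).real E := by
    simp only [measureReal_def]
    rw [Measure.prod_apply hE, integral_toReal (measurable_measure_prodMk_left hE).aemeasurable
      (.of_forall fun _ => measure_lt_top ν _)]
  calc c * μ.real A ≤ c * μ.real {a | c ≤ ν.real (Prod.mk a ⁻¹' E)} := by
        gcongr ?_ * ?_
        exact measureReal_mono hA
    _ ≤ ∫ a, ν.real (Prod.mk a ⁻¹' E) ∂μ :=
        mul_meas_ge_le_integral_of_nonneg (.of_forall fun _ => measureReal_nonneg)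
          (Measure.integrable_measure_prodMk_left hE (measure_ne_top _ _)) c
    _ = (μ.prod ν).real E := hfubini

variable {X ι : Type*} [Fintype ι] [MeasurableSpace X] (D : Measure X) [IsProbabilityMeasure D]

theorem integral_ite_exp_neg_one_le {p : X → Prop} [DecidablePred p]
    (hp : MeasurableSet {x | p x}) :
    ∫ x, (if p x then Real.exp (-1) else 1) ∂D ≤ Real.exp (-(D.real {x | p x} / 2)) := by
  have hexp : Real.exp (-1) ≤ 1 / 2 := by linarith [Real.exp_neg_one_lt_d9]
  have hind : (fun x => if p x then Real.exp (-1) else 1) =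
      fun x => 1 - {x | p x}.indicator (fun _ => 1 - Real.exp (-1)) x := by
    ext x
    by_cases hx : p x <;> simp [hx]
  rw [hind, integral_sub (integrable_const _) ((integrable_const _).indicator hp),
    integral_indicator_const _ hp]
  simp only [integral_const, probReal_univ, smul_eq_mul, mul_one]
  calc 1 - D.real {x | p x} * (1 - Real.exp (-1)) ≤ -(D.real {x | p x} / 2) + 1 := by
        nlinarith [measureReal_nonneg (μ := D) (s := {x | p x})]
    _ ≤ Real.exp (-(D.real {x | p x} / 2)) := Real.add_one_le_exp _

theorem measureReal_card_filter_le_le_exp {p : X → Prop} [DecidablePred p]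
    (hp : MeasurableSet {x | p x}) (c : ℝ) :
    (Measure.pi fun _ : ι => D).real {x | (#{i | p (x i)} : ℝ) ≤ c} ≤
      Real.exp (c - Fintype.card ι * D.real {x | p x} / 2) := by
  set g : X → ℝ := fun x => if p x then Real.exp (-1) else 1
  have hg0 (x : X) : 0 ≤ g x := by simp only [g]; split_ifs <;> positivity
  have hg1 (x : X) : g x ≤ 1 := by simp only [g]; split_ifs <;> simp
  have hgmeas : Measurable g := Measurable.ite hp measurable_const measurable_const
  have hprod (x : ι → X) : ∏ i, g (x i) = Real.exp (-#{i | p (x i)}) := by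
    simp [g, Finset.prod_ite, ← Real.exp_nat_mul]
  have hprod0 (x : ι → X) : 0 ≤ ∏ i, g (x i) := Finset.prod_nonneg fun i _ => hg0 _
  have hint : Integrable (fun x : ι → X => ∏ i, g (x i)) (Measure.pi fun _ => D) := by
    refine .of_bound (Measurable.aestronglyMeasurable <| Finset.univ.measurable_fun_prod
      fun i _ => hgmeas.comp (measurable_pi_apply i)) 1 (.of_forall fun x => ?_)
    rw [Real.norm_of_nonneg (hprod0 x)]
    exact Finset.prod_le_one (fun i _ => hg0 _) fun i _ => hg1 _
  have hmarkov := mul_meas_ge_le_integral_of_nonneg (.of_forall hprod0) hint (Real.exp (-c))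
  rw [integral_fintype_prod_eq_pow] at hmarkov
  simp only [hprod, Real.exp_le_exp, neg_le_neg_iff] at hmarkov
  refine le_of_mul_le_mul_left (hmarkov.trans ?_) (Real.exp_pos (-c))
  calc (∫ x, g x ∂D) ^ Fintype.card ι
      ≤ Real.exp (-(D.real {x | p x} / 2)) ^ Fintype.card ι := by
        gcongr
        exact integral_ite_exp_neg_one_le D hp
    _ = Real.exp (-c) * Real.exp (c - Fintype.card ι * D.real {x | p x} / 2) := by
        rw [← Real.exp_nat_mul, ← Real.exp_add]
        congr 1
        ring

theorem half_le_measureReal_ceil_le_card_filter {p : X → Prop} [DecidablePred p]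
    (hp : MeasurableSet {x | p x}) {ε : ℝ} (hε : ε ≤ D.real {x | p x})
    (hcard : 4 ≤ ε * Fintype.card ι) :
    1 / 2 ≤ (Measure.pi fun _ : ι => D).real
      {x | ⌈ε * Fintype.card ι / 4⌉₊ ≤ #{i | p (x i)}} := by
  set E : Set (ι → X) := {x | ⌈ε * Fintype.card ι / 4⌉₊ ≤ #{i | p (x i)}}
  have htail : (Measure.pi fun _ : ι => D).real Eᶜ ≤ 1 / 2 := by
    calc (Measure.pi fun _ : ι => D).real Eᶜ
        ≤ (Measure.pi fun _ : ι => D).real {x | (#{i | p (x i)} : ℝ) ≤ ε * Fintype.card ι / 4} :=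
          measureReal_mono fun x hx => (Nat.lt_ceil.1 (not_le.1 hx)).le
      _ ≤ Real.exp (ε * Fintype.card ι / 4 - Fintype.card ι * D.real {x | p x} / 2) :=
          measureReal_card_filter_le_le_exp D hp _
      _ ≤ Real.exp (-1) := by
          gcongr
          linarith [mul_le_mul_of_nonneg_right hε (Fintype.card ι).cast_nonneg]
      _ ≤ 1 / 2 := by linarith [Real.exp_neg_one_lt_d9]
  have hunion := measureReal_union_le (μ := Measure.pi fun _ : ι => D) E Eᶜ
  rw [Set.union_compl_self, probReal_univ] at hunion
  linarith

variable [Countable X] [MeasurableSingletonClass X]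

theorem half_mul_measureReal_missed_le {H : Set (X → Bool)} {ε : ℝ}
    (hcard : 4 ≤ ε * Fintype.card ι) :
    1 / 2 * (Measure.pi fun _ : ι => D).real
        {x | ∃ h ∈ H, ε < D.real {x | h x} ∧ ∀ i, h (x i) = false} ≤
      (Measure.pi fun _ : ι => D.prod D).real
        {y | ∃ h ∈ H, y ∈ ghostEvent h ⌈ε * Fintype.card ι / 4⌉₊} := by
  set μ := Measure.pi fun _ : ι => D
  set k := ⌈ε * Fintype.card ι / 4⌉₊
  set A : Set (ι → X) := {x | ∃ h ∈ H, ε < D.real {x | h x} ∧ ∀ i, h (x i) = false}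
  set E : Set ((ι → X) × (ι → X)) :=
    {q | ∃ h ∈ H, (∀ i, h (q.1 i) = false) ∧ k ≤ #{i | h (q.2 i)}}
  have hE : (Measure.pi fun _ : ι => D.prod D).real {y | ∃ h ∈ H, y ∈ ghostEvent h k} =
      (μ.prod μ).real E :=
    (measurePreserving_arrowProdEquivProdArrow X X ι (fun _ => D) fun _ => D).measureReal_preimage
      (s := E) MeasurableSet.of_discrete.nullMeasurableSet
  have hfiber {x : ι → X} (hx : x ∈ A) : 1 / 2 ≤ μ.real (Prod.mk x ⁻¹' E) := by
    obtain ⟨h, hh, hε, hx⟩ := hx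
    exact (half_le_measureReal_ceil_le_card_filter D .of_discrete hε.le hcard).trans
      (measureReal_mono fun x' hx' => ⟨h, hh, hx, hx'⟩)
  rw [hE]
  exact mul_measureReal_le_measureReal_prod one_half_pos.le .of_discrete fun _ => hfiber

theorem measureReal_missed_le {H : Set (X → Bool)} {ε : ℝ} {N : ℕ}
    (hcard : 4 ≤ ε * Fintype.card ι)
    (hN : ∀ S : Finset X, #S ≤ 2 * Fintype.card ι → (restrictions H S).ncard ≤ N) :
    (Measure.pi fun _ : ι => D).real {x | ∃ h ∈ H, ε < D.real {x | h x} ∧ ∀ i, h (x i) = false} ≤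
      2 * N / 2 ^ ⌈ε * Fintype.card ι / 4⌉₊ := by
  have hlower := half_mul_measureReal_missed_le D (H := H) hcard
  have hupper := measureReal_exists_ghostEvent_le D hN ⌈ε * Fintype.card ι / 4⌉₊
  rw [mul_div_assoc]
  linarith

end EpsilonNet

section ChainOfThought

variable (f fstar : Generator) (T : ℕ)

theorem CoT_succ (x : Str) : CoT f (T + 1) x = CoT f T x ++ [f (CoT f T x)] := by
  simp only [CoT, Function.iterate_succ_apply', applyAppend]

theorem rdrop_CoT (x : Str) : (CoT f T x).rdrop T = x := by
  induction T with
  | zero => exact List.rdrop_zero x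
  | succ T ih => rw [CoT_succ, List.rdrop_concat_succ, ih]

theorem CoT_eq_CoT_iff (x : Str) :
    CoT f T x = CoT fstar T x ↔ ∀ t < T, f (CoT fstar t x) = fstar (CoT fstar t x) := by
  induction T with
  | zero => simp [CoT]
  | succ T ih =>
    rw [Nat.forall_lt_succ_right, ← ih, CoT_succ, CoT_succ, ← List.concat_eq_append,
      ← List.concat_eq_append, List.concat_inj]
    exact and_congr_right fun h => by rw [h]

theorem cotConsistent_cotSample_iff {m : ℕ} (x : Fin m → Str) :
    CoTConsistent f T (cotSample fstar T x) ↔ ∀ i, CoT f T (x i) = CoT fstar T (x i) := by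
  simp only [CoTConsistent, cotSample, List.forall_mem_ofFn_iff, rdrop_CoT, eq_comm]

/-- The indicator of the inputs on which the chain of thought of `f` differs from that of `fstar`,
possibly before its last token: the loss that consistency on a sample controls. -/
def cotLoss (x : Str) : Bool := decide (CoT f T x ≠ CoT fstar T x)

/-- The proper prefixes of the chains of thought of `fstar` on the inputs in `S`: the strings at
which `fstar` is evaluated. -/
def cotPrefixes (S : Finset Str) : Finset Str :=
  (S ×ˢ Finset.range T).image fun p => CoT fstar p.2 p.1

theorem card_cotPrefixes_le (S : Finset Str) : #(cotPrefixes fstar T S) ≤ #S * T := by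
  calc #(cotPrefixes fstar T S) ≤ #(S ×ˢ Finset.range T) := Finset.card_image_le
    _ = #S * T := by rw [Finset.card_product, Finset.card_range]

theorem restrict_cotLoss_factorsThrough (S : Finset Str) :
    (S.restrict ∘ fun f => cotLoss f fstar T).FactorsThrough (cotPrefixes fstar T S).restrict := by
  intro f g hfg
  have hagree {x : Str} (hx : x ∈ S) {t : ℕ} (ht : t < T) :
      f (CoT fstar t x) = g (CoT fstar t x) :=
    congrFun hfg ⟨CoT fstar t x, Finset.mem_image.2 ⟨(x, t), by simp [hx, ht], rfl⟩⟩
  ext ⟨x, hx⟩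
  have hiff : CoT f T x = CoT fstar T x ↔ CoT g T x = CoT fstar T x := by
    simp +contextual only [CoT_eq_CoT_iff, hagree hx]
  simp [cotLoss, hiff]

theorem ncard_restrictions_cotLoss_le {F : Set Generator} {d n : ℕ} (hF : VCdim F ≤ d)
    {S : Finset Str} (hS : #S ≤ n) :
    (restrictions ((fun f => cotLoss f fstar T) '' F) S).ncard ≤
      ∑ i ∈ Finset.Iic d, (n * T).choose i :=
  calc (restrictions ((fun f => cotLoss f fstar T) '' F) S).ncard
      ≤ (restrictions F (cotPrefixes fstar T S)).ncard :=
        ncard_restrictions_image_le (restrict_cotLoss_factorsThrough fstar T S) F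
    _ ≤ ∑ i ∈ Finset.Iic d, (#(cotPrefixes fstar T S)).choose i :=
        ncard_restrictions_le_sum_choose hF _
    _ ≤ ∑ i ∈ Finset.Iic d, (n * T).choose i := by
        gcongr
        exact (card_cotPrefixes_le fstar T S).trans (Nat.mul_le_mul_right T hS)

end ChainOfThought

section ConsistentRules

variable {F : Set Generator} {T : ℕ}

theorem exists_isConsCoT (F : Set Generator) (T : ℕ) : ∃ A : CoTRule, IsConsCoT F T A := by
  classical
  refine ⟨fun S => if h : ∃ f ∈ F, CoTConsistent f T S then e2e h.choose T else fun _ => false,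
    fun S h => ⟨h.choose, h.choose_spec.1, h.choose_spec.2, dif_pos h⟩⟩

variable {A : CoTRule} (hA : IsConsCoT F T A) {fstar : Generator} (hfstar : fstar ∈ F) {m : ℕ}

include hA hfstar

theorem IsConsCoT.exists_eq_e2e (x : Fin m → Str) :
    ∃ f ∈ F, (∀ i, CoT f T (x i) = CoT fstar T (x i)) ∧ A (cotSample fstar T x) = e2e f T := by
  simpa only [cotConsistent_cotSample_iff] using hA (cotSample fstar T x)
    ⟨fstar, hfstar, (cotConsistent_cotSample_iff fstar fstar T x).2 fun _ => rfl⟩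

variable (D : Measure Str) [IsProbabilityMeasure D]

theorem IsConsCoT.exists_cotLoss_missed {ε : ℝ} {x : Fin m → Str}
    (hx : ε < popError D fstar T (A (cotSample fstar T x))) :
    ∃ h ∈ (fun f => cotLoss f fstar T) '' F, ε < D.real {x | h x} ∧ ∀ i, h (x i) = false := by
  obtain ⟨f, hf, hcons, hAf⟩ := hA.exists_eq_e2e hfstar x
  refine ⟨_, ⟨f, hf, rfl⟩, hx.trans_le ?_, fun i => by simp [cotLoss, hcons i]⟩
  rw [hAf, popError]
  refine measureReal_mono fun y hy => decide_eq_true fun h => hy ?_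
  rw [e2e, e2e, h]

theorem IsConsCoT.measureReal_lt_popError_le {d : ℕ} (hF : VCdim F ≤ d) {ε : ℝ}
    (hm : 4 ≤ ε * m) :
    (Measure.pi fun _ : Fin m => D).real
        {x | ε < popError D fstar T (A (cotSample fstar T x))} ≤
      2 * (∑ i ∈ Finset.Iic d, (2 * m * T).choose i : ℕ) / 2 ^ ⌈ε * m / 4⌉₊ := by
  have hmissed := measureReal_missed_le D (ι := Fin m) (by simpa using hm) fun S hS =>
    ncard_restrictions_cotLoss_le fstar T hF hS
  simp only [Fintype.card_fin] at hmissed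
  exact (measureReal_mono fun x hx => hA.exists_cotLoss_missed hfstar D hx).trans hmissed

end ConsistentRules

section SampleSize

/-- The sample complexity of the theorem up to a universal constant. -/
noncomputable def sampleScale (d T : ℕ) (ε δ : ℝ) : ℝ :=
  ε⁻¹ * ((d : ℝ) * max 1 (Real.log T) * max 1 (Real.log ε⁻¹) + Real.log δ⁻¹)

variable {d T : ℕ} {ε δ : ℝ}

theorem sampleScale_nonneg (d T : ℕ) (hε : 0 ≤ ε) (hδ : 0 < δ) (hδ1 : δ ≤ 1) :
    0 ≤ sampleScale d T ε δ := by
  have hlog : 0 ≤ Real.log δ⁻¹ := Real.log_nonneg ((one_le_inv₀ hδ).2 hδ1)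
  unfold sampleScale
  positivity

theorem natCast_le_mul_sampleScale (d T : ℕ) (hε : 0 < ε) (hδ : 0 < δ) (hδ1 : δ ≤ 1) :
    d ≤ ε * sampleScale d T ε δ := by
  have hlog : 0 ≤ Real.log δ⁻¹ := Real.log_nonneg ((one_le_inv₀ hδ).2 hδ1)
  calc (d : ℝ) ≤ d * (max 1 (Real.log T) * max 1 (Real.log ε⁻¹)) :=
        le_mul_of_one_le_right (by positivity)
          (one_le_mul_of_one_le_of_one_le (le_max_left _ _) (le_max_left _ _))
    _ ≤ d * (max 1 (Real.log T) * max 1 (Real.log ε⁻¹)) + Real.log δ⁻¹ :=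
        le_add_of_nonneg_right hlog
    _ = ε * sampleScale d T ε δ := by
        rw [sampleScale, mul_inv_cancel_left₀ hε.ne', mul_assoc]

theorem natCast_le_sampleScale (d T : ℕ) (hε : 0 < ε) (hε1 : ε ≤ 1) (hδ : 0 < δ) (hδ1 : δ ≤ 1) :
    d ≤ sampleScale d T ε δ :=
  (natCast_le_mul_sampleScale d T hε hδ hδ1).trans
    (mul_le_of_le_one_left (sampleScale_nonneg d T hε.le hδ hδ1) hε1)

theorem ceil_mul_sampleScale_le (T : ℕ) (hd : 0 < d) (hε : 0 < ε) (hε1 : ε ≤ 1) (hδ : 0 < δ)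
    (hδ1 : δ ≤ 1) :
    (⌈112 * sampleScale d T ε δ⌉₊ : ℝ) ≤ 113 * sampleScale d T ε δ := by
  have hd1 : (1 : ℝ) ≤ d := by exact_mod_cast hd
  have hscale := natCast_le_sampleScale d T hε hε1 hδ hδ1
  linarith [Nat.ceil_lt_add_one (by linarith : 0 ≤ 112 * sampleScale d T ε δ)]

theorem le_exp_max_one_log_mul {x Q : ℝ} (hx : 0 < x) (hQ : 1 ≤ Q) :
    x ≤ Real.exp (max 1 (Real.log x) * Q) := by
  rw [← Real.log_le_iff_le_exp hx]
  exact (le_max_right _ _).trans (le_mul_of_one_le_right (by positivity) hQ)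

theorem exp_one_mul_div_pow_le_exp {m Q T : ℝ} (hd : 0 < d) (hε : 0 < ε) (hm : 0 ≤ m)
    (hT : 0 ≤ T) (hQ : 1 ≤ Q) (hTQ : T ≤ Real.exp Q) (hεQ : ε⁻¹ ≤ Real.exp Q) :
    (Real.exp 1 * (2 * m * T) / d) ^ d ≤ Real.exp (ε * m / 16 + 6 * (d * Q)) := by
  have h32 : (32 : ℝ) ≤ Real.exp 4 := by
    calc (32 : ℝ) ≤ 2.7 ^ 4 := by norm_num
      _ ≤ Real.exp 1 ^ 4 := by gcongr; linarith [Real.exp_one_gt_d9]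
      _ = Real.exp 4 := by rw [← Real.exp_nat_mul]; norm_num
  -- `e * x ≤ exp x` at `x = ε * m / (16 * d)` absorbs the factor `m`.
  have hbase : Real.exp 1 * (2 * m * T) / d ≤ Real.exp (ε * m / (16 * d) + 6 * Q) := by
    calc Real.exp 1 * (2 * m * T) / d
        = Real.exp 1 * (ε * m / (16 * d)) * 32 * T * ε⁻¹ := by field_simp; ring
      _ ≤ Real.exp (ε * m / (16 * d)) * Real.exp 4 * Real.exp Q * Real.exp Q := by
          gcongr
          exact Real.exp_one_mul_le_exp
      _ = Real.exp (ε * m / (16 * d) + 4 + Q + Q) := by simp only [Real.exp_add]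
      _ ≤ Real.exp (ε * m / (16 * d) + 6 * Q) := Real.exp_le_exp.2 (by linarith)
  calc (Real.exp 1 * (2 * m * T) / d) ^ d
      ≤ Real.exp (ε * m / (16 * d) + 6 * Q) ^ d := by gcongr
    _ = Real.exp (ε * m / 16 + 6 * (d * Q)) := by
        rw [← Real.exp_nat_mul]
        congr 1
        field_simp

theorem exp_div_two_le_two_pow_ceil (x : ℝ) : Real.exp (x / 2) ≤ 2 ^ ⌈x⌉₊ := by
  have hhalf : Real.exp (1 / 2) ≤ 2 := by
    rw [Real.exp_half]
    exact Real.sqrt_le_iff.2 ⟨by norm_num, by linarith [Real.exp_one_lt_three]⟩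
  calc Real.exp (x / 2) ≤ Real.exp (⌈x⌉₊ * (1 / 2)) :=
        Real.exp_le_exp.2 (by linarith [Nat.le_ceil x])
    _ = Real.exp (1 / 2) ^ ⌈x⌉₊ := Real.exp_nat_mul _ _
    _ ≤ 2 ^ ⌈x⌉₊ := by gcongr

theorem two_mul_growth_bound_div_two_pow_le {m : ℕ} (hd : 0 < d) (hT : 1 ≤ T) (hε : 0 < ε)
    (hδ : 0 < δ) (hδ1 : δ ≤ 1) (hm : 112 * sampleScale d T ε δ ≤ m) :
    2 * (Real.exp 1 * (2 * m * T) / d) ^ d / 2 ^ ⌈ε * m / 4⌉₊ ≤ δ := by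
  set Q := max 1 (Real.log T) * max 1 (Real.log ε⁻¹) with hQdef
  have hQ : 1 ≤ Q := one_le_mul_of_one_le_of_one_le (le_max_left _ _) (le_max_left _ _)
  have hTQ : (T : ℝ) ≤ Real.exp Q :=
    le_exp_max_one_log_mul (by positivity) (le_max_left _ _)
  have hεQ : ε⁻¹ ≤ Real.exp Q := by
    rw [hQdef, mul_comm]
    exact le_exp_max_one_log_mul (by positivity) (le_max_left _ _)
  have hgrowth := exp_one_mul_div_pow_le_exp hd hε m.cast_nonneg T.cast_nonneg hQ hTQ hεQ
  have hdQ : 1 ≤ d * Q := one_le_mul_of_one_le_of_one_le (by exact_mod_cast hd) hQ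
  have hlog : 0 ≤ Real.log δ⁻¹ := Real.log_nonneg ((one_le_inv₀ hδ).2 hδ1)
  have hscale : 112 * (d * Q + Real.log δ⁻¹) ≤ ε * m := by
    calc 112 * (d * Q + Real.log δ⁻¹) = ε * (112 * sampleScale d T ε δ) := by
          rw [sampleScale, hQdef]
          field_simp
      _ ≤ ε * m := by gcongr
  have htwo : (2 : ℝ) ≤ Real.exp (d * Q) :=
    Real.exp_one_gt_two.le.trans (Real.exp_le_exp.2 hdQ)
  calc 2 * (Real.exp 1 * (2 * m * T) / d) ^ d / 2 ^ ⌈ε * m / 4⌉₊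
      ≤ Real.exp (d * Q) * Real.exp (ε * m / 16 + 6 * (d * Q)) / Real.exp (ε * m / 4 / 2) := by
        gcongr
        exact exp_div_two_le_two_pow_ceil _
    _ = Real.exp (7 * (d * Q) - ε * m / 16) := by
        rw [← Real.exp_add, ← Real.exp_sub]
        congr 1
        ring
    -- This step fixes the constant `112 = 16 * 7`.
    _ ≤ Real.exp (Real.log δ) := by
        rw [Real.log_inv] at hscale hlog
        gcongr
        linarith
    _ = δ := Real.exp_log hδ

end SampleSize

section Learning

variable {F : Set Generator} {d T : ℕ} {A : CoTRule}

theorem IsConsCoT.cotLearnsWith_of_subsingleton (hA : IsConsCoT F T A) (hF : F.Subsingleton)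
    (m : ℝ → ℝ → ℕ) : CoTLearnsWith F T A m := by
  intro D _ fstar hfstar ε δ hε _ hδ _
  have hzero (x : Fin (m ε δ) → Str) : popError D fstar T (A (cotSample fstar T x)) = 0 := by
    obtain ⟨f, hf, -, hAf⟩ := hA.exists_eq_e2e hfstar x
    simp [hAf, hF hf hfstar, popError]
  simpa [hzero, hε.le] using hδ.le

theorem IsConsCoT.cotLearnsWith (hA : IsConsCoT F T A) (hF : VCdim F ≤ d) (hd : 0 < d)
    (hT : 1 ≤ T) {m : ℝ → ℝ → ℕ} (hm : ∀ ε δ, 112 * sampleScale d T ε δ ≤ m ε δ) :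
    CoTLearnsWith F T A m := by
  intro D _ fstar hfstar ε δ hε hε1 hδ hδ1
  have hm := hm ε δ
  set n := m ε δ
  have hd1 : (1 : ℝ) ≤ d := by exact_mod_cast hd
  have hscale := natCast_le_sampleScale d T hε hε1.le hδ hδ1.le
  have hdn : d ≤ 2 * n * T := by
    have hd2n : d ≤ 2 * n := by exact_mod_cast (by linarith : (d : ℝ) ≤ 2 * n)
    exact hd2n.trans (Nat.le_mul_of_pos_right _ hT)
  have h4 : 4 ≤ ε * n := by
    linarith [natCast_le_mul_sampleScale d T hε hδ hδ1.le, mul_le_mul_of_nonneg_left hm hε.le]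
  have hfail : (Measure.pi fun _ : Fin n => D).real
      {x | popError D fstar T (A (cotSample fstar T x)) ≤ ε}ᶜ ≤ δ := by
    calc (Measure.pi fun _ : Fin n => D).real
          {x | popError D fstar T (A (cotSample fstar T x)) ≤ ε}ᶜ
        = (Measure.pi fun _ : Fin n => D).real
          {x | ε < popError D fstar T (A (cotSample fstar T x))} := by
          simp only [Set.compl_ofPred, not_le]
      _ ≤ 2 * (∑ i ∈ Finset.Iic d, (2 * n * T).choose i : ℕ) / 2 ^ ⌈ε * n / 4⌉₊ :=
          hA.measureReal_lt_popError_le hfstar D hF h4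
      _ ≤ 2 * (Real.exp 1 * (2 * n * T) / d) ^ d / 2 ^ ⌈ε * n / 4⌉₊ := by
          gcongr
          exact_mod_cast sum_choose_le_exp_one_mul_div_pow hd hdn
      _ ≤ δ := two_mul_growth_bound_div_two_pow_le hd hT hε hδ hδ1.le hm
  rw [probReal_compl_eq_one_sub .of_discrete] at hfail
  linarith

end Learning

end CoTLearning

theorem mainTheorem2 :
    ∃ C : ℝ, 0 < C ∧
      ∀ (F : Set CoTLearning.Generator) (d : ℕ), CoTLearning.VCdim F = d →
        ∀ T : ℕ, 1 ≤ T →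
          ∃ m : ℝ → ℝ → ℕ,
            (∀ ε δ : ℝ, 0 < ε → ε < 1 → 0 < δ → δ < 1 →
              (m ε δ : ℝ) ≤ C * (ε⁻¹ *
                ((d : ℝ) * max 1 (Real.log T) * max 1 (Real.log ε⁻¹) + Real.log δ⁻¹))) ∧
            (∃ A : CoTLearning.CoTRule, CoTLearning.IsConsCoT F T A) ∧
            ∀ A : CoTLearning.CoTRule, CoTLearning.IsConsCoT F T A →
              ∀ m' : ℝ → ℝ → ℕ, (∀ ε δ : ℝ, m ε δ ≤ m' ε δ) →
                CoTLearning.CoTLearnsWith F T A m' := by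
  refine ⟨113, by norm_num, fun F d hF T hT => ?_⟩
  rcases Nat.eq_zero_or_pos d with rfl | hd
  · refine ⟨fun _ _ => 0, fun ε δ hε _ hδ hδ1 => ?_, CoTLearning.exists_isConsCoT F T,
      fun A hA m' _ => hA.cotLearnsWith_of_subsingleton
        (CoTLearning.subsingleton_of_VCdim_eq_zero hF) m'⟩
    exact Nat.cast_zero.trans_le
      (mul_nonneg (by norm_num) (CoTLearning.sampleScale_nonneg 0 T hε.le hδ hδ1.le))
  · exact ⟨fun ε δ => ⌈112 * CoTLearning.sampleScale d T ε δ⌉₊,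
      fun ε δ hε hε1 hδ hδ1 => CoTLearning.ceil_mul_sampleScale_le T hd hε hε1.le hδ hδ1.le,
      CoTLearning.exists_isConsCoT F T, fun A hA m' hm' => hA.cotLearnsWith hF.le hd hT
        fun ε δ => (Nat.le_ceil _).trans (by exact_mod_cast hm' ε δ)⟩
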